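/- Let $q=2$. For integers $n$ and $e\ge 0$, the binary Reed–Muller code $\mathrm{RM}(n,e)\subseteq\mathbb F_2^{2^n}$ consists of the evaluations, at all points of the affine space $\mathbb A^n(\mathbb F_2)$, of the polynomials in $\mathbb F_2[X_1,\dots,X_n]$ that are zero or of degree at most $e$. For $d\ge 1$, the binary projective Reed–Muller code $\mathrm{PRM}(n,d)\subseteq\mathbb F_2^{2^{n+1}-1}$ consists of the evaluations, at all points of $\mathbb P^n(\mathbb F_2)$ (written so that the first nonzero coordinate is $1$), of the polynomials in $\mathbb F_2[X_0,\dots,X_n]$ that are zero or homogeneous of degree $d$. The next-to-minimal weight of a linear code is the second smallest value of the Hamming weight on its nonzero codewords; write $W^{(2)}_{\mathrm{RM}}(n,e)$ and $W^{(2)}_{\mathrm{PRM}}(n,d)$ for the next-to-minimal weights of $\mathrm{RM}(n,e)$ and $\mathrm{PRM}(n,d)$. Let $2\le d\le n$ and write $d-1=k+1$, so that $0\le k\le n-2$. Then all the next-to-minimal weights below exist, and: 1. if $0<k<n-2$, then $W^{(2)}_{\mathrm{PRM}}(n,d)=W^{(2)}_{\mathrm{RM}}(n,d-1)=3\cdot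 2^{n-k-2}$; 2. if $k=n-2\ge 0$, then $W^{(2)}_{\mathrm{PRM}}(n,d)=W^{(2)}_{\mathrm{RM}}(n,d-1)=4$; 3. if $k=0$ and $n\ge 3$ (so $d=2$), then $W^{(2)}_{\mathrm{PRM}}(n,d)=3\cdot 2^{n-2}<2^n=W^{(2)}_{\mathrm{RM}}(n,d-1)$, and the codeword of $\mathrm{PRM}(n,2)$ given by the quadric $X_0X_3+X_1X_2$ has weight $3\cdot 2^{n-2}$. -/

import Mathlib

namespace ReedMuller

open MvPolynomial

/-- The set of nonzero Hamming weights of the codewords of a linear code `C ⊆ K^ι`. -/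
def nonzeroWeights {K ι : Type*} [Field K] [DecidableEq K] [Fintype ι]
    (C : Submodule K (ι → K)) : Set ℕ :=
  {w | ∃ c ∈ C, c ≠ 0 ∧ hammingNorm c = w}

/-- `w` is the minimal weight (the minimum distance) `W⁽¹⁾` of `C`. -/
def IsMinimalWeight {K ι : Type*} [Field K] [DecidableEq K] [Fintype ι]
    (C : Submodule K (ι → K)) (w : ℕ) : Prop :=
  IsLeast (nonzeroWeights C) w

/-- `w` is the next-to-minimal weight (the second lowest nonzero weight) `W⁽²⁾` of `C`.
This includes that `C` has at least two distinct nonzero weights. -/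
def IsNextToMinimalWeight {K ι : Type*} [Field K] [DecidableEq K] [Fintype ι]
    (C : Submodule K (ι → K)) (w : ℕ) : Prop :=
  ∃ m, IsMinimalWeight C m ∧ IsLeast {x | x ∈ nonzeroWeights C ∧ m < x} w

/-- Evaluation of polynomials in `n` variables at all points of the affine space `𝔸ⁿ(K)`. -/
noncomputable def affineEval (K : Type*) [Field K] (n : ℕ) :
    MvPolynomial (Fin n) K →ₗ[K] ((Fin n → K) → K) :=
  LinearMap.pi fun P => (aeval P).toLinearMap

/-- The (generalized) Reed-Muller code `RM(n, d)`: evaluations at all points of `𝔸ⁿ(K)` of the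
polynomials of degree at most `d` (including `0`). -/
noncomputable def RM (K : Type*) [Field K] (n d : ℕ) : Submodule K ((Fin n → K) → K) :=
  (restrictTotalDegree (Fin n) K d).map (affineEval K n)

/-- The points of the projective space `ℙⁿ(K)` in standard notation: homogeneous coordinates
`(P₀ : ⋯ : Pₙ)` whose first nonzero entry from the left equals `1`. -/
abbrev ProjPoint (K : Type*) [Field K] (n : ℕ) : Type _ :=
  {P : Fin (n + 1) → K // ∃ i, P i = 1 ∧ ∀ j < i, P j = 0}

/-- Evaluation of polynomials in `X₀, …, Xₙ` at the points of `ℙⁿ(K)` (standard notation). -/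
noncomputable def projEval (K : Type*) [Field K] (n : ℕ) :
    MvPolynomial (Fin (n + 1)) K →ₗ[K] (ProjPoint K n → K) :=
  LinearMap.pi fun P => (aeval P.1).toLinearMap

/-- The projective Reed-Muller code `PRM(n, d)`: evaluations at all points of `ℙⁿ(K)` of the
homogeneous polynomials of degree `d` (including `0`). -/
noncomputable def PRM (K : Type*) [Field K] (n d : ℕ) : Submodule K (ProjPoint K n → K) :=
  (homogeneousSubmodule (Fin (n + 1)) K d).map (projEval K n)

end ReedMuller

namespace ReedMuller

open MvPolynomial

/-! Over F₂ each projective point has exactly one representative and forms of positive degree vanish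
at 0, so words of PRM(n,d) have the weights of polynomials of degree at most d in n+1 affine
variables (`hammingNorm_projEval`). Everything reduces to Boolean functions.

In m variables and degree less than r, the minimum weight is at least D = 2^(m-r+1) for r ≤ m, and
the next weight is at least 3D/2 (`DegLT.gap`). Both bounds come by induction on m: split f into
halves g, h; then g + h loses one degree. The gap needs the equality case: words of weight D are
indicators of affine flats (`DegLT.isFlat`).

A rank four quadric times further variables attains 3D/2. For r = m this leaves 3 when D = 2, and
parity excludes it (`DegLT.even_hammingNorm`). In degree one there are no quadrics: a function and
its complement both obey the minimum bound, which leaves only 2^(n-1) and 2^n. -/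

/-- Boolean functions of `m` variables of algebraic degree less than `r`, defined by recursion on
the number of variables through the splitting along the first coordinate. -/
def DegLT : (m r : ℕ) → ((Fin m → ZMod 2) → ZMod 2) → Prop
  | 0, r, f => r = 0 → f = 0
  | m + 1, r, f => DegLT m r (fun x => f (Fin.cons 0 x)) ∧
      DegLT m (r - 1) (fun x => f (Fin.cons 0 x) + f (Fin.cons 1 x))

theorem zmod_two_cases (a : ZMod 2) : a = 0 ∨ a = 1 := by
  revert a; decide

theorem hammingNorm_eq_sum {ι : Type*} [Fintype ι] (f : ι → ZMod 2) :
    hammingNorm f = ∑ i, (f i).val := by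
  classical
  rw [hammingNorm, Finset.card_filter]
  refine Finset.sum_congr rfl fun i _ => ?_
  rcases zmod_two_cases (f i) with h | h <;> simp [h, ZMod.val_one]

theorem sum_fin_cons {m : ℕ} (F : (Fin (m + 1) → ZMod 2) → ℕ) :
    ∑ x, F x = ∑ x, F (Fin.cons 0 x) + ∑ x, F (Fin.cons 1 x) := by
  rw [← (Fin.consEquiv fun _ => ZMod 2).sum_comp, Fintype.sum_prod_type]
  exact Fin.sum_univ_two _

theorem hammingNorm_cons {m : ℕ} (f : (Fin (m + 1) → ZMod 2) → ZMod 2) :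
    hammingNorm f =
      hammingNorm (fun x => f (Fin.cons 0 x)) + hammingNorm (fun x => f (Fin.cons 1 x)) := by
  simp only [hammingNorm_eq_sum]
  exact sum_fin_cons fun x => (f x).val

theorem eq_zero_of_cons {m : ℕ} {f : (Fin (m + 1) → ZMod 2) → ZMod 2}
    (h0 : (fun x => f (Fin.cons 0 x)) = 0) (h1 : (fun x => f (Fin.cons 1 x)) = 0) : f = 0 := by
  rw [← hammingNorm_eq_zero, hammingNorm_cons, h0, h1, hammingNorm_zero]

theorem DegLT.zero (m r : ℕ) : DegLT m r 0 := by
  induction m generalizing r with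
  | zero => exact fun _ => rfl
  | succ m ih =>
    refine ⟨ih r, ?_⟩
    convert ih (r - 1) using 1
    funext x
    simp

theorem DegLT.add {m r : ℕ} {f g : (Fin m → ZMod 2) → ZMod 2} (hf : DegLT m r f)
    (hg : DegLT m r g) : DegLT m r (f + g) := by
  induction m generalizing r with
  | zero => intro h; rw [hf h, hg h, add_zero]
  | succ m ih =>
    refine ⟨ih hf.1 hg.1, ?_⟩
    convert ih hf.2 hg.2 using 1
    funext x
    simp only [Pi.add_apply]
    ring

theorem DegLT.monomial {m r : ℕ} (a : Fin m → ℕ) (c : ZMod 2) (h : ∑ i, a i < r) :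
    DegLT m r (fun x => c * ∏ i, x i ^ a i) := by
  induction m generalizing r with
  | zero => intro hr; omega
  | succ m ih =>
    rw [Fin.sum_univ_succ] at h
    simp only [DegLT, Fin.prod_univ_succ, Fin.cons_zero, Fin.cons_succ, one_pow, one_mul]
    rcases Nat.eq_zero_or_pos (a 0) with h0 | h0
    · simp only [h0, pow_zero, one_mul, CharTwo.add_self_eq_zero]
      exact ⟨ih _ (by omega), DegLT.zero _ _⟩
    · simp only [zero_pow h0.ne', zero_mul, mul_zero, zero_add]
      exact ⟨DegLT.zero _ _, ih _ (by omega)⟩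

/-- Only this direction is needed: bounds are proved for `DegLT`, while the words attaining them are
explicit polynomials. -/
theorem degLT_affineEval {m e : ℕ} {p : MvPolynomial (Fin m) (ZMod 2)} (hp : p.totalDegree ≤ e) :
    DegLT m (e + 1) (affineEval (ZMod 2) m p) := by
  rw [p.as_sum, map_sum]
  refine Finset.sum_induction _ (DegLT m (e + 1)) (fun _ _ => DegLT.add) (DegLT.zero _ _) ?_
  intro a ha
  convert DegLT.monomial (fun i => a i) (p.coeff a) (r := e + 1) ?_ using 1
  · funext x
    simp [affineEval, aeval_monomial, Finsupp.prod_fintype]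
  · have := le_totalDegree ha
    rw [Finsupp.sum_fintype _ _ fun _ => rfl] at this
    omega

theorem DegLT.eq_zero {m : ℕ} {f : (Fin m → ZMod 2) → ZMod 2} (hf : DegLT m 0 f) : f = 0 := by
  induction m with
  | zero => exact hf rfl
  | succ m ih =>
    have h0 := ih hf.1
    have h1 := ih hf.2
    refine eq_zero_of_cons h0 ?_
    funext x
    have := congrFun h1 x
    rwa [congrFun h0 x, Pi.zero_apply, zero_add] at this

theorem DegLT.cons_one {m r : ℕ} {f : (Fin (m + 1) → ZMod 2) → ZMod 2} (hf : DegLT (m + 1) r f) :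
    DegLT m r (fun x => f (Fin.cons 1 x)) := by
  have mono : ∀ {m r : ℕ} {f : (Fin m → ZMod 2) → ZMod 2}, DegLT m (r - 1) f → DegLT m r f := by
    intro m
    induction m with
    | zero => intro r f h hr; exact h (by omega)
    | succ m ih => intro r f h; exact ⟨ih h.1, ih h.2⟩
  convert hf.1.add (mono hf.2) using 1
  funext x
  simp [← add_assoc, CharTwo.add_self_eq_zero]

/-! ### Minimum distance -/

theorem hammingNorm_add_add_inter {ι : Type*} [Fintype ι] (g h : ι → ZMod 2) :
    hammingNorm (g + h) + 2 * hammingNorm (g * h) = hammingNorm g + hammingNorm h := by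
  simp only [hammingNorm_eq_sum, Finset.mul_sum, ← Finset.sum_add_distrib]
  refine Finset.sum_congr rfl fun i _ => ?_
  simp only [Pi.add_apply, Pi.mul_apply]
  generalize g i = a
  generalize h i = b
  revert a b
  decide

theorem hammingNorm_add_le {ι : Type*} [Fintype ι] (g h : ι → ZMod 2) :
    hammingNorm (g + h) ≤ hammingNorm g + hammingNorm h := by
  have := hammingNorm_add_add_inter g h
  omega

theorem eq_of_add_eq_zero {ι : Type*} {g h : ι → ZMod 2} (H : g + h = 0) : h = g := by
  funext x
  exact (CharTwo.add_eq_zero.1 (congrFun H x)).symm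

/-- The two halves of a Boolean function of degree less than `r + 1`. -/
theorem DegLT.split {m r : ℕ} {f : (Fin (m + 1) → ZMod 2) → ZMod 2}
    (hf : DegLT (m + 1) (r + 1) f) (h0 : f ≠ 0) :
    ∃ g h : (Fin m → ZMod 2) → ZMod 2, g = (fun x => f (Fin.cons 0 x)) ∧
      h = (fun x => f (Fin.cons 1 x)) ∧ DegLT m (r + 1) g ∧ DegLT m (r + 1) h ∧
      DegLT m r (g + h) ∧ hammingNorm f = hammingNorm g + hammingNorm h ∧ (g = 0 → h ≠ 0) :=
  ⟨_, _, rfl, rfl, hf.1, hf.cons_one, hf.2, hammingNorm_cons f,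
    fun hg hh => h0 (eq_zero_of_cons hg hh)⟩

/-- The Reed–Muller minimum distance bound. -/
theorem DegLT.le_hammingNorm {m r : ℕ} {f : (Fin m → ZMod 2) → ZMod 2} (hf : DegLT m r f)
    (h0 : f ≠ 0) : 2 ^ (m + 1) ≤ 2 ^ r * hammingNorm f := by
  induction m generalizing r with
  | zero =>
    have hr : r ≠ 0 := fun hr => h0 (hf hr)
    have h1 : 2 ^ (0 + 1) ≤ 2 ^ r := Nat.pow_le_pow_right two_pos (Nat.pos_of_ne_zero hr)
    exact le_mul_of_le_of_one_le h1 (hammingNorm_pos_iff.2 h0)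
  | succ m ih =>
    obtain _ | r := r
    · exact absurd hf.eq_zero h0
    obtain ⟨g, h, -, -, hg, hh, hs, hn, hne⟩ := hf.split h0
    rw [hn]
    by_cases hsz : g + h = 0
    · obtain rfl := eq_of_add_eq_zero hsz
      have := ih hg fun hz => hne hz hz
      rw [pow_succ 2 (m + 1), mul_add]
      omega
    -- Here `g + h` has one degree less, so its bound is already twice that of the halves.
    · have h1 := ih hs hsz
      have h2 := Nat.mul_le_mul_left (2 ^ r) (hammingNorm_add_le g h)
      rw [pow_succ 2 (m + 1), pow_succ 2 r, mul_right_comm]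
      omega

/-! ### Minimum weight words are flats -/

/-- The support of `f` is empty or an affine subspace. -/
def IsFlat {V : Type*} [Add V] (f : V → ZMod 2) : Prop :=
  ∀ x y z, f x = 1 → f y = 1 → f z = 1 → f (x + y + z) = 1

/-- The sum of three points lies in the half that contains an odd number of them; up to order, four
cases remain. -/
theorem isFlat_of_cons {m : ℕ} {f : (Fin (m + 1) → ZMod 2) → ZMod 2}
    {g h : (Fin m → ZMod 2) → ZMod 2} (hg : g = fun x => f (Fin.cons 0 x))
    (hh : h = fun x => f (Fin.cons 1 x)) (fg : IsFlat g) (fh : IsFlat h)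
    (h1 : ∀ x y z, g x = 1 → g y = 1 → h z = 1 → h (x + y + z) = 1)
    (h2 : ∀ x y z, h x = 1 → h y = 1 → g z = 1 → g (x + y + z) = 1) : IsFlat f := by
  have eg : ∀ x, f (Fin.cons 0 x) = g x := fun x => by rw [hg]
  have eh : ∀ x, f (Fin.cons 1 x) = h x := fun x => by rw [hh]
  have e2 : (1 : ZMod 2) + 1 = 0 := by decide
  intro x y z hx hy hz
  have key : x + y + z = Fin.cons (x 0 + y 0 + z 0) (Fin.tail x + Fin.tail y + Fin.tail z) := by
    funext i
    refine Fin.cases ?_ (fun i => ?_) i <;> simp [Fin.tail]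
  rw [key]
  rw [← Fin.cons_self_tail x] at hx
  rw [← Fin.cons_self_tail y] at hy
  rw [← Fin.cons_self_tail z] at hz
  generalize Fin.tail x = x' at *
  generalize Fin.tail y = y' at *
  generalize Fin.tail z = z' at *
  rcases zmod_two_cases (x 0) with hx0 | hx0 <;> rcases zmod_two_cases (y 0) with hy0 | hy0 <;>
    rcases zmod_two_cases (z 0) with hz0 | hz0 <;>
    simp only [hx0, hy0, hz0, eg, eh, add_zero, zero_add, e2] at hx hy hz ⊢
  · exact fg _ _ _ hx hy hz
  · exact h1 _ _ _ hx hy hz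
  · rw [add_right_comm]; exact h1 _ _ _ hx hz hy
  · rw [add_assoc, add_comm]; exact h2 _ _ _ hy hz hx
  · rw [add_assoc, add_comm]; exact h1 _ _ _ hy hz hx
  · rw [add_right_comm]; exact h2 _ _ _ hx hz hy
  · exact h2 _ _ _ hx hy hz
  · exact fh _ _ _ hx hy hz

theorem add_add_add_add_cancel_two {m : ℕ} (x y z : Fin m → ZMod 2) :
    x + y + (x + y + z) = z := by
  have : ∀ a b c : ZMod 2, a + b + (a + b + c) = c := by decide
  funext i
  exact this _ _ _

theorem isFlat_zero {V : Type*} [Add V] : IsFlat (0 : V → ZMod 2) :=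
  fun _ _ _ h => absurd h zero_ne_one

/-- If two disjoint flats have a flat as their union, then they are parallel. -/
theorem IsFlat.parallel {m : ℕ} {g h : (Fin m → ZMod 2) → ZMod 2} (hg : IsFlat g)
    (hs : IsFlat (g + h)) (hd : g * h = 0) {x y z : Fin m → ZMod 2} (hx : g x = 1) (hy : g y = 1)
    (hz : h z = 1) : h (x + y + z) = 1 := by
  have key : ∀ a b : ZMod 2, a * b = 0 → (a = 1 → b = 0) ∧ (b = 1 → a = 0) := by decide
  have hd' : ∀ w, (g w = 1 → h w = 0) ∧ (h w = 1 → g w = 0) := fun w => key _ _ (congrFun hd w)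
  have hw := hs x y z (by simp [hx, (hd' x).1 hx]) (by simp [hy, (hd' y).1 hy])
    (by simp [hz, (hd' z).2 hz])
  rcases zmod_two_cases (g (x + y + z)) with h0 | h1
  · simpa [h0] using hw
  · have := hg x y _ hx hy h1
    rw [add_add_add_add_cancel_two, (hd' z).2 hz] at this
    exact absurd this zero_ne_one

/-- Supports of minimum weight words are flats. -/
theorem DegLT.isFlat {m r : ℕ} {f : (Fin m → ZMod 2) → ZMod 2} (hf : DegLT m r f)
    (hw : 2 ^ r * hammingNorm f = 2 ^ (m + 1)) : IsFlat f := by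
  induction m generalizing r with
  | zero =>
    intro x y z hx _ _
    rwa [Subsingleton.elim (x + y + z) x]
  | succ m ih =>
    have h0 : f ≠ 0 := by
      rintro rfl
      rw [hammingNorm_zero, mul_zero] at hw
      exact (pow_ne_zero _ two_ne_zero) hw.symm
    obtain _ | r := r
    · exact absurd hf.eq_zero h0
    obtain ⟨g, h, eg, eh, hg, hh, hs, hn, hne⟩ := hf.split h0
    rw [hn, pow_succ 2 (m + 1), pow_succ 2 r, mul_right_comm, mul_add] at hw
    have ihg := ih hg
    have ihh := ih hh
    rw [pow_succ 2 r, mul_right_comm] at ihg ihh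
    by_cases hsz : g + h = 0
    · obtain rfl := eq_of_add_eq_zero hsz
      have := ihg (by omega)
      exact isFlat_of_cons eg eh this this this this
    by_cases hgz : g = 0
    · rw [hgz, zero_add] at hs
      rw [hgz, hammingNorm_zero] at hw
      exact isFlat_of_cons eg eh (hgz ▸ isFlat_zero) (ih hs (by omega))
        (by simp [hgz]) (by simp [hgz])
    by_cases hhz : h = 0
    · rw [hhz, add_zero] at hs
      rw [hhz, hammingNorm_zero] at hw
      exact isFlat_of_cons eg eh (ih hs (by omega)) (hhz ▸ isFlat_zero)
        (by simp [hhz]) (by simp [hhz])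
    have bg := hg.le_hammingNorm hgz
    have bh := hh.le_hammingNorm hhz
    have bs := hs.le_hammingNorm hsz
    rw [pow_succ 2 r, mul_right_comm] at bg bh
    have hi := congrArg (2 ^ r * ·) (hammingNorm_add_add_inter g h)
    simp only [mul_add, mul_left_comm (2 ^ r) 2] at hi
    -- Equality forces `g + h` to weigh as much as `g` and `h` together, so their supports are
    -- disjoint.
    have hd : g * h = 0 := by
      have : 2 ^ r * hammingNorm (g * h) = 0 := by omega
      simpa using this
    have fg := ihg (by omega)
    have fh := ihh (by omega)
    have fs := ih hs (by omega)
    exact isFlat_of_cons eg eh fg fh (fun _ _ _ => fg.parallel fs hd)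
      (fun _ _ _ => fh.parallel (by rwa [add_comm]) (by rwa [mul_comm]))

/-- A flat meeting a flat `g` in more than half of `g` contains `g`. -/
theorem IsFlat.mul_eq_left {m : ℕ} {g s : (Fin m → ZMod 2) → ZMod 2} (hg : IsFlat g)
    (hs : IsFlat s) (hlt : hammingNorm g < 2 * hammingNorm (g * s)) : g * s = g := by
  have key : ∀ a b : ZMod 2, a * b = 1 ↔ a = 1 ∧ b = 1 := by decide
  have hI : IsFlat (g * s) := fun x y z hx hy hz => by
    simp only [Pi.mul_apply, key] at hx hy hz ⊢
    exact ⟨hg _ _ _ hx.1 hy.1 hz.1, hs _ _ _ hx.2 hy.2 hz.2⟩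
  have ne0 : ∀ a : ZMod 2, a ≠ 0 ↔ a = 1 := by decide
  by_contra hne
  obtain ⟨x, hx⟩ : ∃ x, (g * s) x ≠ g x := by
    by_contra! H
    exact hne (funext H)
  have key2 : ∀ a b : ZMod 2, a * b ≠ a → a = 1 ∧ b = 0 := by decide
  obtain ⟨hgx, hsx⟩ := key2 _ _ hx
  have hpos : hammingNorm (g * s) ≠ 0 := by omega
  obtain ⟨p, hp⟩ : ∃ p, (g * s) p = 1 := by
    by_contra! H
    refine hpos (hammingNorm_eq_zero.2 (funext fun p => ?_))
    exact (zmod_two_cases _).resolve_right (H p)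
  -- Translation by `p + x`, with `p` in both flats and `x` in `g` only, sends the intersection into
  -- its complement in `g`.
  have hle : hammingNorm (g * s) ≤ hammingNorm (g + g * s) := by
    rw [hammingNorm, hammingNorm]
    refine Finset.card_le_card_of_injOn (fun y => p + x + y) (fun y hy => ?_)
      (fun y _ z _ h => add_left_cancel h)
    simp only [Finset.coe_filter, Finset.mem_univ, true_and, Set.mem_ofPred_eq, ne0] at hy ⊢
    have h1 : g (p + x + y) = 1 := hg _ _ _ ((key _ _).1 hp).1 hgx ((key _ _).1 hy).1
    rcases zmod_two_cases (s (p + x + y)) with h2 | h2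
    · simp [h1, h2]
    · have := hI p y (p + x + y) hp hy (by simp [h1, h2])
      rw [add_right_comm p x y, add_add_add_add_cancel_two] at this
      simp [hsx] at this
  have hi := hammingNorm_add_add_inter g (g * s)
  have : g * (g * s) = g * s := by
    have : ∀ a b : ZMod 2, a * (a * b) = a * b := by decide
    funext y
    exact this _ _
  rw [this] at hi
  omega

/-- The gap above the minimum distance of a binary Reed–Muller code. -/
theorem DegLT.gap {m r : ℕ} {f : (Fin m → ZMod 2) → ZMod 2} (hf : DegLT m r f)
    (hw : 2 ^ (m + 1) < 2 ^ r * hammingNorm f) : 3 * 2 ^ m ≤ 2 ^ r * hammingNorm f := by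
  induction m generalizing r with
  | zero => omega
  | succ m ih =>
    have h0 : f ≠ 0 := by
      rintro rfl
      simp at hw
    obtain _ | r := r
    · exact absurd hf.eq_zero h0
    obtain ⟨g, h, -, -, hg, hh, hs, hn, hne⟩ := hf.split h0
    have ihg := ih hg
    have ihh := ih hh
    have ihs := ih hs
    have bg := hg.le_hammingNorm
    have bh := hh.le_hammingNorm
    have bs := hs.le_hammingNorm
    have flat_g := hg.isFlat
    have flat_h := hh.isFlat
    have flat_s := hs.isFlat
    rw [hn]
    rw [hn] at hw
    -- Normalizing powers makes all bounds linear in `2 ^ m` and the scaled weights, as `omega`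
    -- requires.
    simp only [pow_succ 2 (m + 1), pow_succ 2 m, pow_succ 2 r, mul_right_comm _ 2 (hammingNorm _),
      mul_right_comm _ 2 (_ + _), mul_add]
      at hw ihg ihh ihs bg bh bs flat_g flat_h flat_s ⊢
    by_cases hsz : g + h = 0
    · obtain rfl := eq_of_add_eq_zero hsz
      omega
    by_cases hgz : g = 0
    · rw [hgz, zero_add] at ihs
      rw [hgz, hammingNorm_zero] at hw ⊢
      omega
    by_cases hhz : h = 0
    · rw [hhz, add_zero] at ihs
      rw [hhz, hammingNorm_zero] at hw ⊢
      omega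
    have bg := bg hgz
    have bh := bh hhz
    have bs := bs hsz
    by_contra! hlt
    have hi := congrArg (2 ^ r * ·) (hammingNorm_add_add_inter g h)
    simp only [mul_add, mul_left_comm (2 ^ r) 2] at hi
    -- If `g` weighs D/2, `s` weighs D and `h = g + s` less than D, then `s` covers more than half
    -- of `g`, hence all of it, and `h` weighs D/2.
    have key : ∀ g h s : (Fin m → ZMod 2) → ZMod 2, g + h = s → IsFlat g → IsFlat s →
        2 ^ r * hammingNorm g * 2 = 2 ^ m * 2 → 2 ^ r * hammingNorm s = 2 ^ m * 2 →
        2 ^ r * hammingNorm h * 2 < 2 ^ m * 4 → 2 ^ r * hammingNorm h * 2 = 2 ^ m * 2 := by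
      intro g h s e fg fs eg es lh
      have e' : g + s = h := by
        have : ∀ a b : ZMod 2, a + (a + b) = b := by decide
        rw [← e]
        funext y
        exact this _ _
      have hi := congrArg (2 ^ r * ·) (hammingNorm_add_add_inter g s)
      simp only [mul_add, mul_left_comm (2 ^ r) 2, e'] at hi
      have : hammingNorm g < 2 * hammingNorm (g * s) := by
        refine lt_of_mul_lt_mul_left (a := 2 ^ r) ?_ (Nat.zero_le _)
        rw [mul_left_comm]
        omega
      rw [fg.mul_eq_left fs this] at hi
      omega
    -- The sum weighs less than 3D/2, so by induction exactly D. If neither half weighs D/2, both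
    -- weigh at least 3D/4, which is too much.
    have es : 2 ^ r * hammingNorm (g + h) = 2 ^ m * 2 := by omega
    by_cases cg : 2 ^ r * hammingNorm g * 2 = 2 ^ m * 2
    · have := key g h _ rfl (flat_g cg) (flat_s es) cg es (by omega)
      omega
    · by_cases ch : 2 ^ r * hammingNorm h * 2 = 2 ^ m * 2
      · have := key h g _ (add_comm h g) (flat_h ch) (flat_s es) ch es (by omega)
        omega
      · omega

theorem DegLT.even_hammingNorm {m r : ℕ} {f : (Fin m → ZMod 2) → ZMod 2} (hf : DegLT m r f)
    (hr : r ≤ m) : Even (hammingNorm f) := by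
  induction m generalizing r with
  | zero =>
    rw [hf (by omega), hammingNorm_zero]
    exact Even.zero
  | succ m ih =>
    have hs := ih hf.2 (by omega)
    have hi := hammingNorm_add_add_inter (fun x => f (Fin.cons 0 x)) (fun x => f (Fin.cons 1 x))
    rw [hammingNorm_cons, ← hi]
    exact hs.add (even_two_mul _)

/-! ### Words attaining the bounds -/

/-- The product of the first `e` variables. -/
noncomputable def prefixProd (m e : ℕ) : MvPolynomial (Fin m) (ZMod 2) :=
  ∏ i : Fin m, if i.val < e then X i else 1

theorem isHomogeneous_prefixProd {m e : ℕ} (he : e ≤ m) : (prefixProd m e).IsHomogeneous e := by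
  have h := IsHomogeneous.prod Finset.univ
    (fun i : Fin m => if i.val < e then (X i : MvPolynomial (Fin m) (ZMod 2)) else 1)
    (fun i => if i.val < e then 1 else 0) fun i _ => by
      split_ifs
      · exact isHomogeneous_X _ _
      · exact isHomogeneous_one _ _
  rwa [← Finset.card_filter, Fin.card_filter_val_lt, min_eq_right he] at h

theorem affineEval_apply {K : Type*} [Field K] {n : ℕ} (p : MvPolynomial (Fin n) K)
    (x : Fin n → K) : affineEval K n p x = aeval x p := rfl

theorem affineEval_prefixProd (m e : ℕ) : affineEval (ZMod 2) m (prefixProd m e) =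
    fun x => ∏ i : Fin m, if i.val < e then x i else 1 := by
  funext x
  rw [affineEval_apply, prefixProd, map_prod]
  refine Finset.prod_congr rfl fun i _ => ?_
  split_ifs <;> simp

theorem hammingNorm_prefixProd {m e : ℕ} (he : e ≤ m) :
    hammingNorm (affineEval (ZMod 2) m (prefixProd m e)) = 2 ^ (m - e) := by
  rw [affineEval_prefixProd]
  induction m generalizing e with
  | zero =>
    obtain rfl : e = 0 := by omega
    simp [hammingNorm_eq_sum, ZMod.val_one]
  | succ m ih =>
    obtain _ | e := e
    · simp [hammingNorm_eq_sum, ZMod.val_one]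
    · rw [hammingNorm_cons]
      simp only [Fin.prod_univ_succ, Fin.cons_zero, Fin.cons_succ, Fin.val_succ, Fin.val_zero,
        Nat.add_lt_add_iff_right, Nat.succ_pos, if_true, zero_mul, one_mul]
      rw [ih (by omega), Nat.add_sub_add_right]
      convert Nat.zero_add _
      exact hammingNorm_zero

/-- A rank four quadric times a product of `t` further variables. -/
noncomputable def quadricProd (m t : ℕ) : MvPolynomial (Fin (m + 4)) (ZMod 2) :=
  (X 0 * X 3 + X 1 * X 2) * rename (fun i => i.succ.succ.succ.succ) (prefixProd m t)

theorem isHomogeneous_quadric {n : ℕ} (a b c d : Fin n) :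
    (X a * X b + X c * X d : MvPolynomial (Fin n) (ZMod 2)).IsHomogeneous 2 :=
  ((isHomogeneous_X _ _).mul (isHomogeneous_X _ _)).add
    ((isHomogeneous_X _ _).mul (isHomogeneous_X _ _))

theorem isHomogeneous_quadricProd {m t : ℕ} (ht : t ≤ m) :
    (quadricProd m t).IsHomogeneous (t + 2) := by
  rw [add_comm t]
  exact (isHomogeneous_quadric _ _ _ _).mul (isHomogeneous_prefixProd ht).rename_isHomogeneous

/-- The quadric is nonzero at 6 of the 16 points of F₂⁴. -/
theorem hammingNorm_quadric_mul {m : ℕ} (F : (Fin m → ZMod 2) → ZMod 2) :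
    hammingNorm (fun x : Fin (m + 4) → ZMod 2 =>
      (x 0 * x 3 + x 1 * x 2) * F fun i => x i.succ.succ.succ.succ) = 6 * hammingNorm F := by
  have e1 : (1 : Fin (m + 4)) = Fin.succ 0 := rfl
  have e2 : (2 : Fin (m + 4)) = Fin.succ (Fin.succ 0) := rfl
  have e3 : (3 : Fin (m + 4)) = Fin.succ (Fin.succ (Fin.succ 0)) := rfl
  have hF : hammingNorm (fun x : Fin m → ZMod 2 => F fun i => x i) = hammingNorm F := rfl
  have hz : hammingNorm (fun _ : Fin m → ZMod 2 => (0 : ZMod 2)) = 0 := hammingNorm_zero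
  simp only [hammingNorm_cons, e1, e2, e3, Fin.cons_zero, Fin.cons_succ, zero_mul,
    one_mul, add_zero, zero_add, CharTwo.add_self_eq_zero, hz, hF]
  omega

theorem hammingNorm_quadricProd {m t : ℕ} (ht : t ≤ m) :
    hammingNorm (affineEval (ZMod 2) (m + 4) (quadricProd m t)) = 3 * 2 ^ (m - t + 1) := by
  have h := hammingNorm_quadric_mul (affineEval (ZMod 2) m (prefixProd m t))
  rw [hammingNorm_prefixProd ht] at h
  rw [pow_succ]
  convert h using 1
  · congr 1
    funext x
    simp only [affineEval_apply, quadricProd, map_mul, map_add, aeval_X, aeval_rename,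
      Function.comp_def]
  · ring

/-! ### From codes to Boolean functions -/

theorem hammingNorm_projEval {n d : ℕ} (hd : d ≠ 0) {p : MvPolynomial (Fin (n + 1)) (ZMod 2)}
    (hp : p.IsHomogeneous d) :
    hammingNorm (projEval (ZMod 2) n p) = hammingNorm (affineEval (ZMod 2) (n + 1) p) := by
  rw [hammingNorm, hammingNorm]
  refine Finset.card_bij (fun P _ => P.1) (fun P hP => ?_) (fun P _ Q _ h => Subtype.ext h)
    fun x hx => ?_
  · exact Finset.mem_filter.2 ⟨Finset.mem_univ _, (Finset.mem_filter.1 hP).2⟩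
  · have hx' : aeval x p ≠ 0 := (Finset.mem_filter.1 hx).2
    have hne : ∃ i, x i ≠ 0 := by
      by_contra! h
      obtain rfl : x = 0 := funext h
      apply hx'
      rw [aeval_zero, constantCoeff_eq, hp.coeff_eq_zero (by simpa using hd.symm), map_zero]
    obtain ⟨i, hi, hmin⟩ := WellFounded.has_min (wellFounded_lt (α := Fin (n + 1)))
      {i | x i ≠ 0} hne
    refine ⟨⟨x, i, (zmod_two_cases _).resolve_left hi, fun j hj => ?_⟩, ?_, rfl⟩
    · by_contra h
      exact hmin j h hj
    · exact Finset.mem_filter.2 ⟨Finset.mem_univ _, hx'⟩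

theorem mem_nonzeroWeights_RM {n e : ℕ} {w : ℕ} {p : MvPolynomial (Fin n) (ZMod 2)} {t : ℕ}
    (hp : p.IsHomogeneous t) (ht : t ≤ e) (hw : hammingNorm (affineEval (ZMod 2) n p) = w)
    (h0 : w ≠ 0) : w ∈ nonzeroWeights (RM (ZMod 2) n e) := by
  refine ⟨_, ⟨p, ?_, rfl⟩, ?_, hw⟩
  · exact (mem_restrictTotalDegree _ _ _).2 (hp.totalDegree_le.trans ht)
  · rintro h
    rw [h, hammingNorm_zero] at hw
    exact h0 hw.symm

theorem mem_nonzeroWeights_PRM {n d : ℕ} (hd : d ≠ 0) {w : ℕ}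
    {p : MvPolynomial (Fin (n + 1)) (ZMod 2)} (hp : p.IsHomogeneous d)
    (hw : hammingNorm (affineEval (ZMod 2) (n + 1) p) = w) (h0 : w ≠ 0) :
    w ∈ nonzeroWeights (PRM (ZMod 2) n d) := by
  rw [← hammingNorm_projEval hd hp] at hw
  refine ⟨_, ⟨p, hp, rfl⟩, ?_, hw⟩
  rintro h
  rw [h, hammingNorm_zero] at hw
  exact h0 hw.symm

/-- The nonzero weights of `C` are weights of nonzero Boolean functions of `m` variables of degree
less than `r`. -/
def WeightsOfDegLT {ι : Type*} [Fintype ι] (C : Submodule (ZMod 2) (ι → ZMod 2)) (m r : ℕ) :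
    Prop :=
  ∀ w ∈ nonzeroWeights C, ∃ f, DegLT m r f ∧ f ≠ 0 ∧ hammingNorm f = w

theorem weightsOfDegLT_RM (n e : ℕ) : WeightsOfDegLT (RM (ZMod 2) n e) n (e + 1) := by
  rintro w ⟨_, ⟨p, hp, rfl⟩, h0, hw⟩
  exact ⟨_, degLT_affineEval ((mem_restrictTotalDegree _ _ _).1 hp), h0, hw⟩

theorem weightsOfDegLT_PRM (n : ℕ) {d : ℕ} (hd : d ≠ 0) :
    WeightsOfDegLT (PRM (ZMod 2) n d) (n + 1) (d + 1) := by
  rintro w ⟨_, ⟨p, hp, rfl⟩, h0, hw⟩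
  have h := hammingNorm_projEval hd hp
  exact ⟨_, degLT_affineEval (IsHomogeneous.totalDegree_le hp),
    hammingNorm_ne_zero_iff.1 (h ▸ hammingNorm_ne_zero_iff.2 h0), h.symm.trans hw⟩

section NextToMinimal

variable {ι : Type*} [Fintype ι] {C : Submodule (ZMod 2) (ι → ZMod 2)} {m r : ℕ}

theorem WeightsOfDegLT.isMinimalWeight (hC : WeightsOfDegLT C m r) (hr : r ≤ m)
    (h1 : 2 ^ (m - r + 1) ∈ nonzeroWeights C) : IsMinimalWeight C (2 ^ (m - r + 1)) := by
  refine ⟨h1, fun w hw => ?_⟩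
  obtain ⟨f, hf, h0, rfl⟩ := hC w hw
  refine le_of_mul_le_mul_left (a := 2 ^ r) ?_ (by positivity)
  rw [← pow_add, show r + (m - r + 1) = m + 1 by omega]
  exact hf.le_hammingNorm h0

theorem WeightsOfDegLT.isNextToMinimalWeight (hC : WeightsOfDegLT C m r) (hr : r ≤ m)
    (h1 : 2 ^ (m - r + 1) ∈ nonzeroWeights C) (h2 : 3 * 2 ^ (m - r) ∈ nonzeroWeights C) :
    IsNextToMinimalWeight C (3 * 2 ^ (m - r)) := by
  have hpos : 0 < 2 ^ (m - r) := by positivity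
  refine ⟨_, hC.isMinimalWeight hr h1, ⟨h2, by rw [pow_succ]; omega⟩, ?_⟩
  rintro w ⟨hw, hlt⟩
  obtain ⟨f, hf, h0, rfl⟩ := hC w hw
  refine le_of_mul_le_mul_left (a := 2 ^ r) ?_ (by positivity)
  rw [mul_left_comm, ← pow_add, show r + (m - r) = m by omega]
  refine hf.gap ?_
  rw [show m + 1 = r + (m - r + 1) by omega, pow_add]
  exact Nat.mul_lt_mul_of_pos_left hlt (by positivity)

theorem WeightsOfDegLT.isNextToMinimalWeight_four (hC : WeightsOfDegLT C m m)
    (h1 : 2 ∈ nonzeroWeights C) (h2 : 4 ∈ nonzeroWeights C) : IsNextToMinimalWeight C 4 := by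
  refine ⟨2, by simpa using hC.isMinimalWeight le_rfl (by simpa using h1), ⟨h2, by norm_num⟩, ?_⟩
  rintro w ⟨hw, hlt⟩
  obtain ⟨f, hf, h0, rfl⟩ := hC w hw
  obtain ⟨c, hc⟩ := hf.even_hammingNorm le_rfl
  omega

end NextToMinimal

theorem hammingNorm_one_add {m : ℕ} (f : (Fin m → ZMod 2) → ZMod 2) :
    hammingNorm (1 + f) + hammingNorm f = 2 ^ m := by
  have key : ∀ a : ZMod 2, (1 + a).val + a.val = 1 := by decide
  simp [hammingNorm_eq_sum, ← Finset.sum_add_distrib, key]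

/-! ### Next-to-minimal weights of the codes -/

theorem isNextToMinimalWeight_RM_one {n : ℕ} (hn : 2 ≤ n) :
    IsNextToMinimalWeight (RM (ZMod 2) n 1) (2 ^ n) := by
  have hpow : 2 ^ n = 2 * 2 ^ (n - 2 + 1) := by
    rw [← pow_succ']
    congr 1
    omega
  have hpos : 0 < 2 ^ (n - 2 + 1) := by positivity
  have h1 : 2 ^ (n - 2 + 1) ∈ nonzeroWeights (RM (ZMod 2) n 1) := by
    refine mem_nonzeroWeights_RM (isHomogeneous_prefixProd (e := 1) (by omega)) le_rfl ?_ hpos.ne'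
    rw [hammingNorm_prefixProd (by omega)]
    congr 1
    omega
  have h2 : 2 ^ n ∈ nonzeroWeights (RM (ZMod 2) n 1) :=
    mem_nonzeroWeights_RM (isHomogeneous_prefixProd (Nat.zero_le n)) (Nat.zero_le 1)
      (hammingNorm_prefixProd (Nat.zero_le n)) (by positivity)
  have hmin : IsMinimalWeight (RM (ZMod 2) n 1) (2 ^ (n - 2 + 1)) :=
    (weightsOfDegLT_RM n 1).isMinimalWeight hn h1
  refine ⟨_, hmin, ⟨h2, by omega⟩, ?_⟩
  rintro w ⟨⟨_, ⟨p, hp, rfl⟩, -, rfl⟩, hlt⟩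
  have hsum := hammingNorm_one_add (affineEval (ZMod 2) n p)
  by_cases hz : 1 + affineEval (ZMod 2) n p = 0
  · rw [hz, hammingNorm_zero] at hsum
    omega
  have he : affineEval (ZMod 2) n (1 + p) = 1 + affineEval (ZMod 2) n p := by
    funext x
    simp only [affineEval_apply, map_add, map_one, Pi.add_apply, Pi.one_apply]
  have hdeg : (1 + p).totalDegree ≤ 1 := (totalDegree_add _ _).trans
    (max_le (by simp) ((mem_restrictTotalDegree _ _ _).1 hp))
  have hb := (degLT_affineEval hdeg).le_hammingNorm (he ▸ hz)
  rw [he, pow_succ 2 n] at hb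
  omega

/-- Squaring `X 0` raises the degree without changing the function, so a homogeneous word can have
the weight of a product with one variable fewer. -/
theorem hammingNorm_X_zero_mul_prefixProd {m e : ℕ} (he : e ≤ m) :
    hammingNorm (affineEval (ZMod 2) (m + 1) (X 0 * prefixProd (m + 1) (e + 1))) =
      2 ^ (m - e) := by
  rw [← Nat.add_sub_add_right m 1 e, ← hammingNorm_prefixProd (by omega)]
  congr 1
  have key : ∀ a b : ZMod 2, a * (a * b) = a * b := by decide
  funext x
  rw [affineEval_apply, map_mul, aeval_X, ← affineEval_apply, affineEval_prefixProd]
  simp only [Fin.prod_univ_succ, Fin.val_zero, Nat.succ_pos, if_true, key]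

theorem isNextToMinimalWeight_RM {n t : ℕ} (ht : t + 4 ≤ n) :
    IsNextToMinimalWeight (RM (ZMod 2) n (t + 2)) (3 * 2 ^ (n - (t + 3))) := by
  obtain ⟨m, rfl⟩ : ∃ m, n = m + 4 := ⟨n - 4, by omega⟩
  refine (weightsOfDegLT_RM _ _).isNextToMinimalWeight (by omega) ?_ ?_
  · refine mem_nonzeroWeights_RM (isHomogeneous_prefixProd (e := t + 2) (by omega)) le_rfl ?_
      (by positivity)
    rw [hammingNorm_prefixProd (by omega)]
    congr 1
    omega
  · refine mem_nonzeroWeights_RM (isHomogeneous_quadricProd (m := m) (t := t) (by omega)) le_rfl ?_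
      (by positivity)
    rw [hammingNorm_quadricProd (by omega)]
    congr 2
    omega

theorem isNextToMinimalWeight_PRM {n t : ℕ} (ht : t + 3 ≤ n) :
    IsNextToMinimalWeight (PRM (ZMod 2) n (t + 2)) (3 * 2 ^ (n - (t + 2))) := by
  -- There are n+1 = m+4 variables, so the quadric fits already for n = 3, and `t = 0` covers d = 2.
  obtain ⟨m, rfl⟩ : ∃ m, n = m + 3 := ⟨n - 3, by omega⟩
  have h0 : t + 2 ≠ 0 := by omega
  rw [← Nat.add_sub_add_right _ 1]
  refine (weightsOfDegLT_PRM _ h0).isNextToMinimalWeight (by omega) ?_ ?_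
  · refine mem_nonzeroWeights_PRM h0 (isHomogeneous_prefixProd (by omega)) ?_ (by positivity)
    rw [hammingNorm_prefixProd (by omega)]
    congr 1
    omega
  · refine mem_nonzeroWeights_PRM h0 (isHomogeneous_quadricProd (m := m) (by omega)) ?_
      (by positivity)
    rw [hammingNorm_quadricProd (by omega)]
    congr 2
    omega

theorem isNextToMinimalWeight_RM_sub_one (n : ℕ) :
    IsNextToMinimalWeight (RM (ZMod 2) (n + 2) (n + 1)) 4 := by
  refine (weightsOfDegLT_RM _ _).isNextToMinimalWeight_four ?_ ?_
  · refine mem_nonzeroWeights_RM (isHomogeneous_prefixProd (e := n + 1) (by omega)) le_rfl ?_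
      (by norm_num)
    rw [hammingNorm_prefixProd (by omega), show n + 2 - (n + 1) = 1 by omega, pow_one]
  · refine mem_nonzeroWeights_RM (isHomogeneous_prefixProd (e := n) (by omega)) (by omega) ?_
      (by norm_num)
    rw [hammingNorm_prefixProd (by omega), show n + 2 - n = 2 by omega]
    norm_num

theorem isNextToMinimalWeight_PRM_self (n : ℕ) :
    IsNextToMinimalWeight (PRM (ZMod 2) (n + 2) (n + 2)) 4 := by
  have h0 : n + 2 ≠ 0 := by omega
  refine (weightsOfDegLT_PRM _ h0).isNextToMinimalWeight_four ?_ ?_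
  · refine mem_nonzeroWeights_PRM h0 (isHomogeneous_prefixProd (by omega)) ?_ (by norm_num)
    rw [hammingNorm_prefixProd (by omega), show n + 2 + 1 - (n + 2) = 1 by omega, pow_one]
  · have hh : (X 0 * prefixProd (n + 2 + 1) (n + 1)).IsHomogeneous (n + 2) := by
      rw [show n + 2 = 1 + (n + 1) by omega]
      exact (isHomogeneous_X _ _).mul (isHomogeneous_prefixProd (by omega))
    refine mem_nonzeroWeights_PRM h0 hh ?_ (by norm_num)
    rw [hammingNorm_X_zero_mul_prefixProd (by omega), show n + 2 - n = 2 by omega]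
    norm_num

theorem hammingNorm_projEval_quadric (m : ℕ) :
    hammingNorm (projEval (ZMod 2) (m + 3) (X 0 * X 3 + X 1 * X 2)) = 3 * 2 ^ (m + 1) := by
  rw [hammingNorm_projEval two_ne_zero (isHomogeneous_quadric _ _ _ _)]
  simpa [quadricProd, prefixProd] using hammingNorm_quadricProd (Nat.zero_le m)

end ReedMuller

theorem theorem1 (n d k : ℕ) (hd : 2 ≤ d) (hdn : d ≤ n) (hk : d - 1 = k + 1) :
    (0 < k ∧ k < n - 2 →
      ReedMuller.IsNextToMinimalWeight (ReedMuller.PRM (ZMod 2) n d) (3 * 2 ^ (n - k - 2)) ∧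
      ReedMuller.IsNextToMinimalWeight (ReedMuller.RM (ZMod 2) n (d - 1)) (3 * 2 ^ (n - k - 2))) ∧
    (k = n - 2 →
      ReedMuller.IsNextToMinimalWeight (ReedMuller.PRM (ZMod 2) n d) 4 ∧
      ReedMuller.IsNextToMinimalWeight (ReedMuller.RM (ZMod 2) n (d - 1)) 4) ∧
    (k = 0 ∧ 3 ≤ n →
      ReedMuller.IsNextToMinimalWeight (ReedMuller.PRM (ZMod 2) n d) (3 * 2 ^ (n - 2)) ∧
      ReedMuller.IsNextToMinimalWeight (ReedMuller.RM (ZMod 2) n (d - 1)) (2 ^ n) ∧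
      3 * 2 ^ (n - 2) < 2 ^ n ∧
      ReedMuller.projEval (ZMod 2) n (MvPolynomial.X 0 * MvPolynomial.X 3 + MvPolynomial.X 1 * MvPolynomial.X 2) ∈ ReedMuller.PRM (ZMod 2) n d ∧
      hammingNorm (ReedMuller.projEval (ZMod 2) n (MvPolynomial.X 0 * MvPolynomial.X 3 + MvPolynomial.X 1 * MvPolynomial.X 2)) = 3 * 2 ^ (n - 2)) := by
  obtain rfl : d = k + 2 := by omega
  rw [show k + 2 - 1 = k + 1 by omega]
  refine ⟨fun ⟨h0, h1⟩ => ?_, fun h => ?_, fun ⟨h0, h3⟩ => ?_⟩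
  · obtain ⟨t, rfl⟩ : ∃ t, k = t + 1 := ⟨k - 1, by omega⟩
    rw [show n - (t + 1) - 2 = n - (t + 3) by omega]
    exact ⟨ReedMuller.isNextToMinimalWeight_PRM (by omega),
      ReedMuller.isNextToMinimalWeight_RM (by omega)⟩
  · obtain rfl : n = k + 2 := by omega
    exact ⟨ReedMuller.isNextToMinimalWeight_PRM_self k,
      ReedMuller.isNextToMinimalWeight_RM_sub_one k⟩
  · subst h0
    obtain ⟨m, rfl⟩ : ∃ m, n = m + 3 := ⟨n - 3, by omega⟩
    refine ⟨ReedMuller.isNextToMinimalWeight_PRM (by omega),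
      ReedMuller.isNextToMinimalWeight_RM_one (by omega), ?_,
      ⟨_, ReedMuller.isHomogeneous_quadric _ _ _ _, rfl⟩,
      ReedMuller.hammingNorm_projEval_quadric m⟩
    have : 0 < 2 ^ m := by positivity
    rw [show m + 3 - 2 = m + 1 by omega, pow_succ, pow_add]
    omega
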